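/- **Setting.** Fix $d,E\in\mathbb N$. For every number of clients $Q$ consider one round of federated averaging. Client $k\in\{1,\dots,Q\}$ holds $N_k$ samples with differentiable losses $F_j:\mathbb R^d\to\mathbb R$ ($j\in I_k$, $|I_k|=N_k$) and has a batch size $1\le S\le N_k$; put $$F^k=\frac1{N_k}\sum_{j\in I_k}F_j,\qquad \Sigma_k(w)=\Big(\frac1S-\frac1{N_k}\Big)\frac1{N_k-1}\sum_{j\in I_k}\big(\nabla F_j(w)-\nabla F^k(w)\big)\big(\nabla F_j(w)-\nabla F^k(w)\big)^T$$ (with $\Sigma_k=0$ if $N_k=1$). All clients start the round at the same deterministic server weights $w_0^k=w_0\in\mathbb R^d$ and perform $E$ local steps $$w^k_{i+1}=w^k_i+\eta_k\,(N^k_i-G^k_i),\qquad G^k_i=\nabla F^k(w^k_i),\qquad 0\le i<E,$$ where $\eta_k$ is the learning rate of client $k$ in this round and where, conditionally on $N^k_0,\dots,N^k_{i-1}$, the gradient noise $N^k_i$ has law $\mathcal N(0,\Sigma_k(w^k_i))$. The noises of different clients are independent, and the $G^k_i$ are integrable. With weights $p_k\in\mathbb R$ the aggregated server update is $$A_T=\sum_{k=1}^Q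 p_k\sum_{i=0}^{E-1}\eta_k\,(N^k_i-G^k_i),\qquad M_T=\mathbb E[A_T],\qquad V_T=\mathrm{Cov}(A_T)=\mathbb E[A_TA_T^T]-M_TM_T^T.$$ Put $N_k=\sum_{i<E}N^k_i$ and $R_k=\sum_{i<E}(\mathbb E[G^k_i]-G^k_i)$ (random vectors in $\mathbb R^d$), with coordinates $N_{k,a},R_{k,a}$, and $x_{k,a}=p_k^2\eta_k^2\,\mathbb E[(N_{k,a}+R_{k,a})^2]$. All of this data ($p_k$, $\eta_k$, $w_0$, the clients, the probability space) may depend on $Q$. **Theorem 3.** Assume that there are constants $B$, $C>0$ and $D$, independent of $Q$, such that for all $Q$, all clients $k\le Q$ and all coordinates $a\le d$: 1. $|p_k\eta_k|\le B$; 2. $\Sigma_k(w^k_i)$ is almost surely a diagonal matrix for $0\le i<E$; 3. $\displaystyle C\le x_{k,a}^2-\frac1{2Q}\sum_{j=1}^Q\big(x_{k,a}-x_{j,a}\big)^2$; 4. for all integers $u,v\ge 0$ with $u+v=4$, the variable $N_{k,a}^uR_{k,a}^v$ is integrable and $\big|\mathbb E[N_{k,a}^uR_{k,a}^v]\big|\le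 D$. Then $A_T$ is asymptotically $\mathcal N(M_T,V_T)$ as $Q\to\infty$, in the following sense. For every $Q$ the vector $A_T$ is square integrable, and $(V_T)_{aa}>0$ for all $a$ if $Q\ge1$. Let $s_Q:\mathbb R^d\to\mathbb R^d$ be the standardization $s_Q(x)_a=(x_a-(M_T)_a)/\sqrt{(V_T)_{aa}}$. Then each coordinate of $s_Q(A_T)$ converges in distribution to $\mathcal N(0,1)$, and jointly, for every bounded continuous $f:\mathbb R^d\to\mathbb R$, $$\mathbb E\big[f(s_Q(A_T))\big]-\int f(s_Q(x))\,d\mathcal N(M_T,V_T)(x)\longrightarrow 0\qquad(Q\to\infty).$$ -/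

import Mathlib

open MeasureTheory ProbabilityTheory Filter
open scoped Topology Gradient BoundedContinuousFunction

noncomputable section

namespace FedAvg

/-- The space of model weights `ℝ^d`. -/
abbrev Weights (d : ℕ) : Type := EuclideanSpace ℝ (Fin d)

/-- A client: its finitely many samples, given through their losses, and its batch size. -/
structure Client (d : ℕ) where
  /-- the number `N_k` of samples held by the client -/
  numSamples : ℕ
  /-- the losses `F_j` of these samples -/
  sampleLoss : Fin numSamples → Weights d → ℝ
  differentiable_sampleLoss : ∀ j, Differentiable ℝ (sampleLoss j)
  /-- the size `S` of a random batch -/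
  batchSize : ℕ
  one_le_batchSize : 1 ≤ batchSize
  batchSize_le : batchSize ≤ numSamples

namespace Client

variable {d : ℕ} (c : Client d)

/-- The local objective `F^k(w) = (1 / N_k) ∑_j F_j(w)`. -/
def loss (w : Weights d) : ℝ :=
  (1 / (c.numSamples : ℝ)) * ∑ j, c.sampleLoss j w

/-- The covariance matrix of a stochastic gradient (batches drawn without replacement),
`Σ_k(w) = (1/S - 1/N_k) (1/(N_k - 1)) ∑_j (∇F_j(w) - ∇F^k(w)) (∇F_j(w) - ∇F^k(w))ᵀ`.
(If `N_k = 1` then `S = 1` and the first factor vanishes.) -/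
def gradCov (w : Weights d) : Matrix (Fin d) (Fin d) ℝ :=
  ((1 / (c.batchSize : ℝ) - 1 / (c.numSamples : ℝ)) * (1 / ((c.numSamples : ℝ) - 1))) •
    ∑ j, Matrix.vecMulVec (⇑(∇ (c.sampleLoss j) w - ∇ c.loss w))
      (⇑(∇ (c.sampleLoss j) w - ∇ c.loss w))

/-- The local SGD iterates started at `w₀` with constant learning rate `η`, driven by the
gradient noise `n`: `w_{i+1} = w_i + η (n_i - ∇F^k(w_i))`. -/
def iterate (η : ℝ) (w₀ : Weights d) (n : ℕ → Weights d) : ℕ → Weights d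
  | 0 => w₀
  | i + 1 => iterate η w₀ n i + η • (n i - ∇ c.loss (iterate η w₀ n i))

end Client

/-- The data of one communication round with `Q` clients, over a sample space `Ω`. -/
structure Round (d Q : ℕ) (Ω : Type*) where
  client : Fin Q → Client d
  /-- the aggregation weights `p_k` -/
  p : Fin Q → ℝ
  /-- the client learning rates `η_k`, constant during the round -/
  η : Fin Q → ℝ
  /-- the server weights at the beginning of the round -/
  w₀ : Weights d
  /-- `noise k i` is the gradient noise of client `k` in its local iteration `i` -/
  noise : Fin Q → ℕ → Ω → Weights d

namespace Round

variable {d Q : ℕ} {Ω : Type*} (𝓡 : Round d Q Ω)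

/-- The weights of client `k` after `i` local iterations. -/
def weights (k : Fin Q) (i : ℕ) (ω : Ω) : Weights d :=
  (𝓡.client k).iterate (𝓡.η k) 𝓡.w₀ (fun j => 𝓡.noise k j ω) i

/-- The full local gradient `G^k_i = ∇F^k(w^k_i)` at the `i`-th local iterate. -/
def grad (k : Fin Q) (i : ℕ) (ω : Ω) : Weights d :=
  ∇ (𝓡.client k).loss (𝓡.weights k i ω)

/-- The aggregated server update `A_T = ∑_k p_k ∑_{i<E} η_k (N^k_i - G^k_i)`. -/
def update (E : ℕ) (ω : Ω) : Weights d :=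
  ∑ k, 𝓡.p k • ∑ i ∈ Finset.range E, 𝓡.η k • (𝓡.noise k i ω - 𝓡.grad k i ω)

/-- `N_k = ∑_{i<E} N^k_i`. -/
def totalNoise (E : ℕ) (k : Fin Q) (ω : Ω) : Weights d :=
  ∑ i ∈ Finset.range E, 𝓡.noise k i ω

variable [MeasurableSpace Ω] (P : Measure Ω)

/-- `R_k = ∑_{i<E} (𝔼[G^k_i] - G^k_i)`. -/
def totalDev (E : ℕ) (k : Fin Q) (ω : Ω) : Weights d :=
  ∑ i ∈ Finset.range E, ((∫ ω', 𝓡.grad k i ω' ∂P) - 𝓡.grad k i ω)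

/-- The scaled second moment `p_k² η_k² 𝔼[(N_{k,a} + R_{k,a})²]` of coordinate `a`. -/
def scaledMoment (E : ℕ) (k : Fin Q) (a : Fin d) : ℝ :=
  𝓡.p k ^ 2 * 𝓡.η k ^ 2 *
    ∫ ω, (𝓡.totalNoise E k ω a + 𝓡.totalDev P E k ω a) ^ 2 ∂P

/-- The mean vector `M_T = 𝔼[A_T]`. -/
def mean (E : ℕ) : Weights d := ∫ ω, 𝓡.update E ω ∂P

/-- The covariance matrix `V_T` of `A_T`. -/
def covMatrix (E : ℕ) : Matrix (Fin d) (Fin d) ℝ :=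
  Matrix.of fun a b => cov[fun ω => 𝓡.update E ω a, fun ω => 𝓡.update E ω b; P]

/-- The affine map that centers at `M_T` and divides coordinate `a` by `√(V_T)_{aa}`. -/
def standardize (E : ℕ) (x : Weights d) : Weights d :=
  WithLp.toLp 2 fun a => (x a - 𝓡.mean P E a) / √(𝓡.covMatrix P E a a)

/-- The probabilistic model of a round with `E` local iterations: given the past of client `k`,
its `i`-th gradient noise has law `𝒩(0, Σ_k(w^k_i))`; different clients are independent; the
full gradients are integrable, so that `𝔼[G^k_i]` makes sense. -/
structure IsModel (E : ℕ) [IsProbabilityMeasure P] : Prop where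
  measurable_noise : ∀ k, ∀ i < E, Measurable (𝓡.noise k i)
  condDistrib_noise : ∀ k, ∀ i < E, ∀ᵐ ω ∂P,
    condDistrib (𝓡.noise k i) (fun ω' (j : Fin i) => 𝓡.noise k j ω') P
        (fun j : Fin i => 𝓡.noise k j ω) =
      multivariateGaussian 0 ((𝓡.client k).gradCov (𝓡.weights k i ω))
  indep : iIndepFun (fun k ω (i : Fin E) => 𝓡.noise k i ω) P
  integrable_grad : ∀ k, ∀ i < E, Integrable (𝓡.grad k i) P

end Round

end FedAvg

end

namespace FedAvg

open Matrix

/-! ### Lyapunov-type bounds for characteristic functions on the line -/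

section CharacteristicFunctionBounds

/-! This is a Lyapunov central limit theorem for a triangular array. `update_sub_mean` writes `A_T -
M_T` as the sum over clients of `p_k η_k (N_k + R_k)`; the summands are centered, and independent
because each is a function of one client's noise. Hypothesis 3 gives `√C ≤ x_{k,a}`, so each
diagonal variance is at least `Q √C`, and after standardization every summand has fourth moment
`O(Q⁻²)`. Taylor expansion and telescoping of products then put the characteristic function within
`O(Q^(-1/2))` of that of the Gaussian with the same correlation matrix
(`norm_charFun_standardize_sub_exp_le`).

The correlation matrices need not converge as `Q → ∞`. `tendsto_integral_sub_gaussian` therefore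
argues by compactness: along subsequences they converge, and by Lévy's theorem both laws have the
same Gaussian limit.

Normality of the gradient noise enters only as symmetry of its conditional law. Flipping the sign of
the last noise preserves the joint law with the past; this gives mean zero and passes integrability
from the total noise to its terms (`memLp_partialNoise`). -/

lemma norm_exp_mul_I_sub_taylor_le (x : ℝ) :
    ‖Complex.exp (x * Complex.I) - (1 + x * Complex.I - x ^ 2 / 2)‖ ≤ 4 * |x| ^ 3 := by
  rcases le_or_gt |x| 1 with hx | hx
  · have hn : ‖(x * Complex.I : ℂ)‖ = |x| := by simp
    have h := Complex.exp_bound (x := x * Complex.I) (by rwa [hn]) (n := 3) (by norm_num)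
    rw [hn] at h
    have hs : ∑ m ∈ Finset.range 3, (x * Complex.I) ^ m / (m.factorial : ℂ) =
        1 + x * Complex.I - x ^ 2 / 2 := by
      simp [Finset.sum_range_succ, Nat.factorial, mul_pow]
      ring
    rw [hs] at h
    refine h.trans ?_
    norm_num [Nat.factorial]
    nlinarith [pow_nonneg (abs_nonneg x) 3]
  · have h1 : ‖(1 + x * Complex.I - x ^ 2 / 2 : ℂ)‖ ≤ 1 + |x| + |x| ^ 2 / 2 := by
      refine (norm_sub_le _ _).trans (add_le_add ((norm_add_le _ _).trans ?_) ?_) <;> simp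
    have h2 := norm_sub_le (Complex.exp (x * Complex.I)) (1 + x * Complex.I - x ^ 2 / 2)
    rw [Complex.norm_exp_ofReal_mul_I] at h2
    have h3 : |x| ≤ |x| ^ 2 := by nlinarith
    have h4 : |x| ^ 2 ≤ |x| ^ 3 := by nlinarith [sq_nonneg |x|]
    linarith

lemma abs_exp_neg_sub_le {y : ℝ} (hy : 0 ≤ y) : |Real.exp (-y) - (1 - y)| ≤ y ^ 2 := by
  have h1 := Real.add_one_le_exp (-y)
  rw [abs_of_nonneg (by linarith)]
  rcases le_or_gt y 1 with h | h
  · have h2 := Real.norm_exp_sub_one_sub_id_le (x := -y) (by simpa [abs_of_nonneg hy] using h)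
    have h3 := (le_abs_self _).trans h2
    simp only [norm_neg, Real.norm_eq_abs, sq_abs] at h3
    linarith
  · have h2 : Real.exp (-y) ≤ 1 := by simpa using hy
    nlinarith

lemma norm_prod_sub_prod_le {ι : Type*} (s : Finset ι) (a b : ι → ℂ)
    (ha : ∀ i, ‖a i‖ ≤ 1) (hb : ∀ i, ‖b i‖ ≤ 1) :
    ‖∏ i ∈ s, a i - ∏ i ∈ s, b i‖ ≤ ∑ i ∈ s, ‖a i - b i‖ := by
  classical
  induction s using Finset.induction_on with
  | empty => simp
  | insert j s hj ih =>
    rw [Finset.prod_insert hj, Finset.prod_insert hj, Finset.sum_insert hj]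
    have hp : ‖∏ i ∈ s, a i‖ ≤ 1 := by
      rw [norm_prod]
      exact Finset.prod_le_one (fun _ _ => norm_nonneg _) fun i _ => ha i
    calc ‖a j * ∏ i ∈ s, a i - b j * ∏ i ∈ s, b i‖
        = ‖(a j - b j) * ∏ i ∈ s, a i + b j * (∏ i ∈ s, a i - ∏ i ∈ s, b i)‖ := by ring_nf
      _ ≤ ‖a j - b j‖ * ‖∏ i ∈ s, a i‖ + ‖b j‖ * ‖∏ i ∈ s, a i - ∏ i ∈ s, b i‖ := by
          refine (norm_add_le _ _).trans ?_
          rw [norm_mul, norm_mul]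
      _ ≤ ‖a j - b j‖ * 1 + 1 * ∑ i ∈ s, ‖a i - b i‖ := by
          gcongr
          exact hb j
      _ = _ := by ring

/-- Splitting at the threshold `c` controls the third absolute moment by the fourth without
fractional powers; `c` is optimized later. -/
lemma abs_pow_three_le {c : ℝ} (hc : 0 < c) (y : ℝ) : |y| ^ 3 ≤ c ^ 3 + y ^ 4 / c := by
  rcases le_or_gt |y| c with h | h
  · have := pow_le_pow_left₀ (abs_nonneg y) h 3
    have : 0 ≤ y ^ 4 / c := by positivity
    linarith
  · have h1 : |y| ^ 3 ≤ y ^ 4 / c := by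
      rw [le_div_iff₀ hc, ← Even.pow_abs (by decide : Even 4) y, pow_succ |y| 3]
      gcongr
    have : 0 ≤ c ^ 3 := by positivity
    linarith

variable {Ω : Type*} [MeasurableSpace Ω] {P : Measure Ω}

lemma integrable_pow_of_memLp [IsFiniteMeasure P] {Y : Ω → ℝ} (hY : MemLp Y 4 P) {n : ℕ}
    (hn : n ≤ 4) : Integrable (fun ω => Y ω ^ n) P := by
  have h : MemLp Y (n : ENNReal) P := hY.mono_exponent (by exact_mod_cast hn)
  refine (integrable_norm_iff (hY.1.pow n)).1 ?_
  simpa using h.integrable_norm_pow'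

lemma memLp_four_of_integrable_pow {Y : Ω → ℝ} (hY : AEStronglyMeasurable Y P)
    (h : Integrable (fun ω => Y ω ^ 4) P) : MemLp Y 4 P := by
  refine (integrable_norm_rpow_iff hY (by norm_num) (by norm_num)).1 ?_
  convert h.norm using 2 with ω
  rw [norm_pow]
  simp only [ENNReal.toReal_ofNat]
  exact_mod_cast Real.rpow_natCast _ 4

variable [IsProbabilityMeasure P]

/-- The variance of `Y ^ 2` is nonnegative. -/
lemma sq_integral_sq_le {Y : Ω → ℝ} (hY : MemLp Y 4 P) :
    (∫ ω, Y ω ^ 2 ∂P) ^ 2 ≤ ∫ ω, Y ω ^ 4 ∂P := by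
  have h2 := integrable_pow_of_memLp hY (n := 2) (by norm_num)
  have h4 := integrable_pow_of_memLp hY (n := 4) (by norm_num)
  set m := ∫ ω, Y ω ^ 2 ∂P
  have h : 0 ≤ ∫ ω, (Y ω ^ 2 - m) ^ 2 ∂P := integral_nonneg fun ω => sq_nonneg _
  have he : ∀ ω, (Y ω ^ 2 - m) ^ 2 = Y ω ^ 4 - 2 * m * Y ω ^ 2 + m ^ 2 := fun ω => by ring
  simp_rw [he] at h
  have h42 : Integrable (fun ω => Y ω ^ 4 - 2 * m * Y ω ^ 2) P := h4.sub (h2.const_mul _)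
  rw [integral_add h42 (integrable_const _), integral_sub h4 (h2.const_mul _), integral_const_mul] at h
  simp only [integral_const, probReal_univ, one_smul] at h
  have : ∫ ω, Y ω ^ 2 ∂P = m := rfl
  rw [this] at h
  nlinarith

/-- Comparison of the characteristic function of a centered random variable with that of the
Gaussian of the same variance. -/
lemma norm_integral_exp_sub_exp_le {Y : Ω → ℝ} (hY : MemLp Y 4 P) (h0 : ∫ ω, Y ω ∂P = 0)
    {K : ℝ} (hK : ∫ ω, Y ω ^ 4 ∂P ≤ K) {c : ℝ} (hc : 0 < c) :
    ‖∫ ω, Complex.exp (Y ω * Complex.I) ∂P - Complex.exp (-((∫ ω, Y ω ^ 2 ∂P : ℝ) : ℂ) / 2)‖ ≤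
      4 * (c ^ 3 + K / c) + K := by
  have h1 : Integrable Y P := by
    simpa using integrable_pow_of_memLp hY (n := 1) (by norm_num)
  have h2 := integrable_pow_of_memLp hY (n := 2) (by norm_num)
  have h4 := integrable_pow_of_memLp hY (n := 4) (by norm_num)
  set m := ∫ ω, Y ω ^ 2 ∂P with hm
  have hm0 : 0 ≤ m := integral_nonneg fun ω => sq_nonneg _
  have hmeas := hY.1.aemeasurable
  have hE : Integrable (fun ω => Complex.exp (Y ω * Complex.I)) P := by
    refine Integrable.of_bound (C := 1) ?_ ?_
    · exact AEMeasurable.aestronglyMeasurable (by fun_prop)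
    · exact ae_of_all _ fun ω => by rw [Complex.norm_exp_ofReal_mul_I]
  have hT1 : Integrable (fun ω => 1 + (Y ω : ℂ) * Complex.I) P :=
    (integrable_const _).add (h1.ofReal.mul_const _)
  have hT2 : Integrable (fun ω => (Y ω : ℂ) ^ 2 / 2) P := by
    simpa using h2.ofReal (𝕜 := ℂ) |>.div_const 2
  have hTI : ∫ ω, (1 + (Y ω : ℂ) * Complex.I - (Y ω : ℂ) ^ 2 / 2) ∂P = 1 - (m : ℂ) / 2 := by
    rw [integral_sub hT1 hT2, integral_add (integrable_const _) (h1.ofReal.mul_const _),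
      integral_mul_const, integral_div, integral_complex_ofReal, h0]
    have : ∫ ω, (Y ω : ℂ) ^ 2 ∂P = (m : ℂ) := by
      rw [hm, ← integral_complex_ofReal]
      simp
    simp [this]
  have hA : ‖∫ ω, Complex.exp (Y ω * Complex.I) ∂P - (1 - (m : ℂ) / 2)‖ ≤
      4 * (c ^ 3 + K / c) := by
    have hT : Integrable (fun ω => 1 + (Y ω : ℂ) * Complex.I - (Y ω : ℂ) ^ 2 / 2) P := hT1.sub hT2
    rw [← hTI, ← integral_sub hE hT]
    calc _ ≤ ∫ ω, 4 * (c ^ 3 + Y ω ^ 4 / c) ∂P := by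
          refine norm_integral_le_of_norm_le ?_ (ae_of_all _ fun ω => ?_)
          · exact ((integrable_const _).add (h4.div_const c)).const_mul 4
          · refine (norm_exp_mul_I_sub_taylor_le (Y ω)).trans ?_
            gcongr
            exact abs_pow_three_le hc _
      _ = 4 * (c ^ 3 + (∫ ω, Y ω ^ 4 ∂P) / c) := by
          rw [integral_const_mul, integral_add (integrable_const _) (h4.div_const c), integral_div]
          simp
      _ ≤ _ := by gcongr
  -- The error is at most `m ^ 2 / 4`, and `m ^ 2` is bounded by the fourth moment.
  have hB : ‖(1 - (m : ℂ) / 2) - Complex.exp (-(m : ℂ) / 2)‖ ≤ K := by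
    have h := abs_exp_neg_sub_le (y := m / 2) (by positivity)
    have he : (1 - (m : ℂ) / 2) - Complex.exp (-(m : ℂ) / 2) =
        ((-(Real.exp (-(m / 2)) - (1 - m / 2)) : ℝ) : ℂ) := by
      push_cast
      ring_nf
    rw [he, Complex.norm_real, norm_neg, Real.norm_eq_abs]
    have := sq_integral_sq_le hY
    nlinarith
  calc _ ≤ _ := norm_sub_le_norm_sub_add_norm_sub _ (1 - (m : ℂ) / 2) _
    _ ≤ _ := add_le_add hA hB

/-- Comparison of the characteristic function of a sum of independent centered random variables
with that of the Gaussian of the same variance. -/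
lemma norm_integral_exp_sum_sub_exp_le {Q : ℕ} (hQ : 0 < Q) {Y : Fin Q → Ω → ℝ}
    (hind : iIndepFun Y P) (hY : ∀ k, MemLp (Y k) 4 P) (h0 : ∀ k, ∫ ω, Y k ω ∂P = 0) {K : ℝ}
    (hK : ∀ k, ∫ ω, Y k ω ^ 4 ∂P ≤ K / (Q : ℝ) ^ 2) :
    ‖∫ ω, Complex.exp ((∑ k, Y k ω : ℝ) * Complex.I) ∂P -
        Complex.exp (-((∑ k, ∫ ω, Y k ω ^ 2 ∂P : ℝ) : ℂ) / 2)‖ ≤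
      (4 + 5 * K) / √(Q : ℝ) := by
  have hprod : ∫ ω, Complex.exp ((∑ k, Y k ω : ℝ) * Complex.I) ∂P =
      ∏ k, ∫ ω, Complex.exp (Y k ω * Complex.I) ∂P := by
    rw [← hind.integral_fun_prod_comp (𝓧 := fun _ => ℝ) (f := fun _ (y : ℝ) => Complex.exp (y * Complex.I))
      (fun k => (hY k).1.aemeasurable)
      (fun k => AEMeasurable.aestronglyMeasurable (by fun_prop))]
    refine integral_congr_ae (ae_of_all _ fun ω => ?_)
    simp only [Complex.ofReal_sum, Finset.sum_mul, Complex.exp_sum]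
  have hprod' : Complex.exp (-((∑ k, ∫ ω, Y k ω ^ 2 ∂P : ℝ) : ℂ) / 2) =
      ∏ k, Complex.exp (-((∫ ω, Y k ω ^ 2 ∂P : ℝ) : ℂ) / 2) := by
    rw [← Complex.exp_sum, Complex.ofReal_sum, ← Finset.sum_div, Finset.sum_neg_distrib]
  rw [hprod, hprod']
  have hs : 0 < √(Q : ℝ) := Real.sqrt_pos.2 (by exact_mod_cast hQ)
  have hs1 : 1 ≤ √(Q : ℝ) := Real.one_le_sqrt.2 (by exact_mod_cast hQ)
  have hsq : √(Q : ℝ) ^ 2 = Q := Real.sq_sqrt (Nat.cast_nonneg _)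
  have hK0 : 0 ≤ K := by
    have h := (integral_nonneg (μ := P) (f := fun ω => Y ⟨0, hQ⟩ ω ^ 4)
      fun ω => by positivity).trans (hK ⟨0, hQ⟩)
    by_contra hneg
    have : K / (Q : ℝ) ^ 2 < 0 := div_neg_of_neg_of_pos (not_le.1 hneg) (by positivity)
    linarith
  refine (norm_prod_sub_prod_le _ _ _ (fun k => ?_) fun k => ?_).trans ?_
  · refine (norm_integral_le_of_norm_le_const (C := 1) (ae_of_all _ fun ω => ?_)).trans ?_
    · rw [Complex.norm_exp_ofReal_mul_I]
    · simp
  · rw [Complex.norm_exp]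
    refine Real.exp_le_one_iff.2 ?_
    have : 0 ≤ ∫ ω, Y k ω ^ 2 ∂P := integral_nonneg fun ω => sq_nonneg _
    rw [← Complex.ofReal_neg, ← Complex.ofReal_ofNat, ← Complex.ofReal_div, Complex.ofReal_re]
    linarith
  -- With fourth moments of order `Q⁻²`, the choice `c = Q^(-1/2)` makes both `c ^ 3` and the
  -- fourth-moment term of order `Q^(-3/2)`; summing over `Q` terms leaves `Q^(-1/2)`.
  · refine (Finset.sum_le_sum fun k _ =>
      norm_integral_exp_sub_exp_le (hY k) (h0 k) (hK k) (c := 1 / √(Q : ℝ)) (by positivity)).trans ?_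
    rw [Finset.sum_const, Finset.card_univ, Fintype.card_fin, nsmul_eq_mul]
    set s := √(Q : ℝ)
    rw [← hsq]
    have he : s ^ 2 * (4 * ((1 / s) ^ 3 + K / (s ^ 2) ^ 2 / (1 / s)) + K / (s ^ 2) ^ 2) =
        (4 + 4 * K + K / s) / s := by
      field_simp
    rw [he]
    refine div_le_div_of_nonneg_right ?_ hs.le
    have : K / s ≤ K := div_le_self hK0 hs1
    linarith

end CharacteristicFunctionBounds

/-! ### Covariance matrices as quadratic forms -/

section CovarianceMatrix

variable {Ω ι : Type*} [Fintype ι] [MeasurableSpace Ω] {P : Measure Ω} [IsFiniteMeasure P]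

lemma dotProduct_covariance_mulVec {X : ι → Ω → ℝ} (hX : ∀ a, MemLp (X a) 2 P) (t : ι → ℝ) :
    t ⬝ᵥ (Matrix.of fun a b => cov[X a, X b; P]) *ᵥ t = Var[fun ω => ∑ a, t a * X a ω; P] := by
  rw [variance_fun_sum fun a => (hX a).const_mul (t a)]
  simp only [dotProduct, mulVec, Matrix.of_apply, Finset.mul_sum, covariance_const_mul_left,
    covariance_const_mul_right]
  exact Finset.sum_congr rfl fun a _ => Finset.sum_congr rfl fun b _ => by ring

lemma posSemidef_covariance {X : ι → Ω → ℝ} (hX : ∀ a, MemLp (X a) 2 P) :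
    (Matrix.of fun a b => cov[X a, X b; P]).PosSemidef := by
  refine Matrix.PosSemidef.of_dotProduct_mulVec_nonneg ?_ fun t => ?_
  · ext a b
    simp [covariance_comm (X a)]
  · rw [star_trivial, dotProduct_covariance_mulVec hX]
    exact variance_nonneg _ _

end CovarianceMatrix

/-! ### Weak comparison with a varying family of Gaussians -/

section WeakComparison

variable {d : ℕ}

lemma isClosed_posSemidef : IsClosed {S : Matrix (Fin d) (Fin d) ℝ | S.PosSemidef} := by
  have h : {S : Matrix (Fin d) (Fin d) ℝ | S.PosSemidef} =
      {S | Sᴴ = S} ∩ ⋂ t : Fin d → ℝ, {S | 0 ≤ star t ⬝ᵥ S *ᵥ t} := by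
    ext S
    simp only [Set.mem_inter_iff, Set.mem_iInter, Set.mem_ofPred_eq]
    exact ⟨fun hS => ⟨hS.1, fun t => hS.dotProduct_mulVec_nonneg t⟩,
      fun hS => Matrix.PosSemidef.of_dotProduct_mulVec_nonneg hS.1 hS.2⟩
  rw [h]
  refine (isClosed_eq (by fun_prop) continuous_id).inter (isClosed_iInter fun t => ?_)
  exact isClosed_le continuous_const (by fun_prop)

/-- Testing the quadratic form on `e_a ± e_b` gives `0 ≤ S a a ± 2 S a b + S b b`. This confines
correlation matrices to a compact cube. -/
lemma abs_apply_le_of_posSemidef {S : Matrix (Fin d) (Fin d) ℝ} (hS : S.PosSemidef)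
    (h1 : ∀ a, S a a ≤ 1) (a b : Fin d) : |S a b| ≤ 1 := by
  have hsymm : S b a = S a b := by simpa using congrFun (congrFun hS.1 a) b
  have key : ∀ e : ℝ, 0 ≤ S a a + 2 * e * S a b + e ^ 2 * S b b := fun e => by
    have h := hS.dotProduct_mulVec_nonneg (Pi.single a 1 + e • Pi.single b 1)
    simp only [star_trivial, mulVec_add, dotProduct_add, add_dotProduct, mulVec_smul,
      smul_dotProduct, dotProduct_smul, mulVec_single_one, single_one_dotProduct, col_apply,
      smul_eq_mul, hsymm] at h
    linarith
  have hp := key 1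
  have hm := key (-1)
  have ha := h1 a
  have hb := h1 b
  rw [abs_le]
  constructor <;> linarith

/-- A sequence of probability measures whose characteristic functions approach those of Gaussians
with bounded covariance matrices has the same weak asymptotics as these Gaussians. -/
lemma tendsto_integral_sub_gaussian (μ : ℕ → ProbabilityMeasure (Weights d))
    (ρ : ℕ → Matrix (Fin d) (Fin d) ℝ) (hρ : ∀ n, (ρ n).PosSemidef) (h1 : ∀ n a, ρ n a a ≤ 1)
    (hμ : ∀ t : Weights d, Tendsto (fun n => charFun (μ n : Measure (Weights d)) t -
      Complex.exp (-((t.ofLp ⬝ᵥ ρ n *ᵥ t.ofLp : ℝ) : ℂ) / 2)) atTop (𝓝 0))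
    (f : Weights d →ᵇ ℝ) :
    Tendsto (fun n => ∫ x, f x ∂(μ n : Measure (Weights d)) -
      ∫ x, f x ∂multivariateGaussian 0 (ρ n)) atTop (𝓝 0) := by
  -- It suffices that every subsequence has a further one along which the difference tends to zero;
  -- compactness of the cube supplies one where the covariances converge.
  refine tendsto_of_subseq_tendsto fun ns hns => ?_
  have hcomp : IsCompact (Set.univ.pi fun _ : Fin d => Set.univ.pi fun _ : Fin d =>
      Set.Icc (-1 : ℝ) 1) := isCompact_univ_pi fun _ => isCompact_univ_pi fun _ => isCompact_Icc
  obtain ⟨S, -, φ, hφ, hS⟩ := hcomp.tendsto_subseq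
    (x := fun n => (fun a b => ρ (ns n) a b : Fin d → Fin d → ℝ)) fun n a _ b _ =>
    abs_le.1 (abs_apply_le_of_posSemidef (hρ _) (h1 _) a b)
  have hS' : Tendsto (fun n => ρ (ns (φ n))) atTop (𝓝 (S : Matrix (Fin d) (Fin d) ℝ)) := hS
  have hSpos : Matrix.PosSemidef (S : Matrix (Fin d) (Fin d) ℝ) :=
    isClosed_posSemidef.mem_of_tendsto hS' (Eventually.of_forall fun n => hρ _)
  refine ⟨φ, ?_⟩
  have hsub : Tendsto (fun n => ns (φ n)) atTop atTop := hns.comp hφ.tendsto_atTop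
  have hquad : ∀ t : Weights d, Tendsto
      (fun n => Complex.exp (-((t.ofLp ⬝ᵥ ρ (ns (φ n)) *ᵥ t.ofLp : ℝ) : ℂ) / 2)) atTop
      (𝓝 (Complex.exp (-((t.ofLp ⬝ᵥ (S : Matrix (Fin d) (Fin d) ℝ) *ᵥ t.ofLp : ℝ) : ℂ) / 2))) :=
    fun t => by
      have hc : Continuous fun M : Matrix (Fin d) (Fin d) ℝ =>
          Complex.exp (-((t.ofLp ⬝ᵥ M *ᵥ t.ofLp : ℝ) : ℂ) / 2) := by fun_prop
      exact (hc.tendsto _).comp hS'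
  have hchar : ∀ M : Matrix (Fin d) (Fin d) ℝ, M.PosSemidef → ∀ t : Weights d,
      charFun (multivariateGaussian 0 M) t =
        Complex.exp (-((t.ofLp ⬝ᵥ M *ᵥ t.ofLp : ℝ) : ℂ) / 2) := fun M hM t => by
    rw [charFun_multivariateGaussian hM]
    simp [neg_div]
  let γ : Matrix (Fin d) (Fin d) ℝ → ProbabilityMeasure (Weights d) :=
    fun M => ⟨multivariateGaussian 0 M, inferInstance⟩
  have hA : Tendsto (fun n => μ (ns (φ n))) atTop (𝓝 (γ S)) := by
    refine ProbabilityMeasure.tendsto_iff_tendsto_charFun.2 fun t => ?_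
    have h := ((hμ t).comp hsub).add (hquad t)
    simpa [γ, hchar S hSpos] using h
  have hB : Tendsto (fun n => γ (ρ (ns (φ n)))) atTop (𝓝 (γ S)) := by
    refine ProbabilityMeasure.tendsto_iff_tendsto_charFun.2 fun t => ?_
    simpa [γ, hchar _ hSpos, hchar _ (hρ _)] using hquad t
  have hf := (ProbabilityMeasure.tendsto_iff_forall_integral_tendsto.1 hA f).sub
    (ProbabilityMeasure.tendsto_iff_forall_integral_tendsto.1 hB f)
  simpa [γ] using hf

/-- The image of a Gaussian under centering and a diagonal rescaling. -/
lemma map_multivariateGaussian_rescale (m : Weights d) {V : Matrix (Fin d) (Fin d) ℝ}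
    (hV : V.PosSemidef) (r : Fin d → ℝ) {ρ : Matrix (Fin d) (Fin d) ℝ} (hρ : ρ.PosSemidef)
    (hρV : ∀ a b, ρ a b = r a * r b * V a b) :
    (multivariateGaussian m V).map
        (fun x => (WithLp.toLp 2 fun a => r a * (x a - m a) : Weights d)) =
      multivariateGaussian 0 ρ := by
  have hmeas : Measurable fun x : Weights d =>
      (WithLp.toLp 2 fun a => r a * (x a - m a) : Weights d) := by fun_prop
  have := Measure.isProbabilityMeasure_map (μ := multivariateGaussian m V) hmeas.aemeasurable
  refine Measure.ext_of_charFun (funext fun t => ?_)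
  -- The diagonal rescaling is self-adjoint, so it can be moved onto the frequency `t`; the phase
  -- from centering cancels that of the mean `m`.
  let u : Weights d := WithLp.toLp 2 fun a => r a * t a
  rw [charFun_multivariateGaussian hρ, charFun_apply,
    integral_map hmeas.aemeasurable (Measurable.aestronglyMeasurable (by fun_prop))]
  have hin : ∀ x : Weights d,
      Complex.exp ((inner ℝ (WithLp.toLp 2 fun a => r a * (x a - m a) : Weights d) t : ℝ) *
        Complex.I) = Complex.exp ((inner ℝ x u : ℝ) * Complex.I) *
          Complex.exp (-(inner ℝ u m : ℝ) * Complex.I) := fun x => by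
    rw [← Complex.exp_add, ← add_mul, ← Complex.ofReal_neg, ← Complex.ofReal_add]
    congr 3
    simp only [PiLp.inner_apply, u, RCLike.inner_apply, conj_trivial, ← Finset.sum_neg_distrib,
      ← Finset.sum_add_distrib]
    exact Finset.sum_congr rfl fun a _ => by ring
  simp_rw [hin]
  rw [integral_mul_const, ← charFun_apply, charFun_multivariateGaussian hV, ← Complex.exp_add]
  congr 1
  have hq : u.ofLp ⬝ᵥ V *ᵥ u.ofLp = t.ofLp ⬝ᵥ ρ *ᵥ t.ofLp := by
    simp only [dotProduct, mulVec, Finset.mul_sum, hρV, u]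
    exact Finset.sum_congr rfl fun a _ => Finset.sum_congr rfl fun b _ => by ring
  rw [hq]
  simp only [inner_zero_right, Complex.ofReal_zero]
  ring

end WeakComparison

/-! ### Central limit bound for vector-valued triangular arrays -/

section TriangularArray

variable {d : ℕ}

/-- Cauchy–Schwarz applied twice. -/
lemma sum_pow_four_le (y : Fin d → ℝ) : (∑ a, y a) ^ 4 ≤ (d : ℝ) ^ 3 * ∑ a, y a ^ 4 := by
  have h1 := sq_sum_le_card_mul_sum_sq (s := Finset.univ) (f := y)
  have h2 := sq_sum_le_card_mul_sum_sq (s := Finset.univ) (f := fun a => y a ^ 2)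
  simp only [Finset.card_univ, Fintype.card_fin, ← pow_mul] at h1 h2
  calc (∑ a, y a) ^ 4 = ((∑ a, y a) ^ 2) ^ 2 := by ring
    _ ≤ (d * ∑ a, y a ^ 2) ^ 2 := by gcongr
    _ = (d : ℝ) ^ 2 * (∑ a, y a ^ 2) ^ 2 := by ring
    _ ≤ (d : ℝ) ^ 2 * (d * ∑ a, y a ^ 4) := by gcongr
    _ = _ := by ring

variable {Ω : Type*} [MeasurableSpace Ω] {P : Measure Ω} [IsProbabilityMeasure P]

/-- Cramér–Wold reduction: projecting on `t` gives a scalar array. Coordinates of one summand may be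
dependent; the factor `d ^ 3` pays for this in the fourth moment. -/
lemma norm_charFun_sum_sub_exp_le {Q : ℕ} (hQ : 0 < Q) {X : Fin Q → Ω → Weights d}
    (hXm : ∀ k, Measurable (X k)) (hind : iIndepFun X P) (hX : ∀ k a, MemLp (fun ω => X k ω a) 4 P)
    (h0 : ∀ k a, ∫ ω, X k ω a ∂P = 0) {K : ℝ}
    (hK : ∀ k a, ∫ ω, X k ω a ^ 4 ∂P ≤ K / (Q : ℝ) ^ 2) (t : Weights d) :
    ‖charFun (P.map fun ω => ∑ k, X k ω) t - Complex.exp (-((t.ofLp ⬝ᵥ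
        (Matrix.of fun a b => cov[fun ω => (∑ k, X k ω) a, fun ω => (∑ k, X k ω) b; P]) *ᵥ t.ofLp :
          ℝ) : ℂ) / 2)‖ ≤
      (4 + 5 * ((d : ℝ) ^ 3 * (∑ a, t a ^ 4) * K)) / √(Q : ℝ) := by
  let Y : Fin Q → Ω → ℝ := fun k ω => ∑ a, t a * X k ω a
  have hYind : iIndepFun Y P :=
    hind.comp (fun _ x => ∑ a, t a * x a) (fun _ => by fun_prop)
  have hY4 : ∀ k, MemLp (Y k) 4 P := fun k =>
    memLp_finsetSum _ fun a _ => (hX k a).const_mul (t a)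
  have hX1 : ∀ k a, Integrable (fun ω => X k ω a) P := fun k a => by
    simpa using integrable_pow_of_memLp (hX k a) (n := 1) (by norm_num)
  have hX4 : ∀ k a, Integrable (fun ω => X k ω a ^ 4) P := fun k a =>
    integrable_pow_of_memLp (hX k a) le_rfl
  have hX2 : ∀ k a, MemLp (fun ω => X k ω a) 2 P := fun k a =>
    (hX k a).mono_exponent (by norm_num)
  have hY0 : ∀ k, ∫ ω, Y k ω ∂P = 0 := fun k => by
    simp only [Y]
    rw [integral_finsetSum _ fun a _ => (hX1 k a).const_mul (t a)]
    simp [integral_const_mul, h0]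
  have hYK : ∀ k, ∫ ω, Y k ω ^ 4 ∂P ≤ ((d : ℝ) ^ 3 * (∑ a, t a ^ 4) * K) / (Q : ℝ) ^ 2 :=
    fun k => by
      have hint : ∀ a, Integrable (fun ω => (t a * X k ω a) ^ 4) P := fun a => by
        simpa only [mul_pow] using (hX4 k a).const_mul (t a ^ 4)
      calc ∫ ω, Y k ω ^ 4 ∂P ≤ ∫ ω, (d : ℝ) ^ 3 * ∑ a, (t a * X k ω a) ^ 4 ∂P :=
            integral_mono (integrable_pow_of_memLp (hY4 k) le_rfl)
              ((integrable_finsetSum _ fun a _ => hint a).const_mul _) fun ω => sum_pow_four_le _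
        _ = (d : ℝ) ^ 3 * ∑ a, t a ^ 4 * ∫ ω, X k ω a ^ 4 ∂P := by
            rw [integral_const_mul, integral_finsetSum _ fun a _ => hint a]
            simp only [mul_pow, integral_const_mul]
        _ ≤ (d : ℝ) ^ 3 * ∑ a, t a ^ 4 * (K / (Q : ℝ) ^ 2) := by
            gcongr with a
            exact hK k a
        _ = _ := by rw [← Finset.sum_mul]; ring
  have hsum : ∀ ω, ∑ k, Y k ω = ∑ a, t a * (∑ k, X k ω) a := fun ω => by
    simp only [Y, WithLp.ofLp_sum, Finset.sum_apply, Finset.mul_sum]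
    exact Finset.sum_comm
  have hvar : ∑ k, ∫ ω, Y k ω ^ 2 ∂P = t.ofLp ⬝ᵥ
      (Matrix.of fun a b => cov[fun ω => (∑ k, X k ω) a, fun ω => (∑ k, X k ω) b; P]) *ᵥ
        t.ofLp := by
    rw [dotProduct_covariance_mulVec (X := fun a ω => (∑ k, X k ω) a)]
    · simp_rw [← hsum]
      have h := IndepFun.variance_sum (X := Y) (s := Finset.univ) (μ := P)
        (fun k _ => (hY4 k).mono_exponent (by norm_num))
        (fun i _ j _ hij => hYind.indepFun hij)
      have he : (∑ k, Y k) = fun ω => ∑ k, Y k ω := by ext; simp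
      rw [he] at h
      rw [h]
      refine Finset.sum_congr rfl fun k _ => ?_
      rw [variance_of_integral_eq_zero (hY4 k).1.aemeasurable (hY0 k)]
    · intro a
      simpa using memLp_finsetSum Finset.univ fun k _ => hX2 k a
  have hchar : charFun (P.map fun ω => ∑ k, X k ω) t =
      ∫ ω, Complex.exp ((∑ k, Y k ω : ℝ) * Complex.I) ∂P := by
    rw [charFun_apply, integral_map (Measurable.aemeasurable (by fun_prop))
      (Measurable.aestronglyMeasurable (by fun_prop))]
    refine integral_congr_ae (ae_of_all _ fun ω => ?_)
    simp only [hsum, PiLp.inner_apply, RCLike.inner_apply, conj_trivial]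
  rw [hchar, ← hvar]
  exact norm_integral_exp_sum_sub_exp_le hQ hYind hY4 hY0 hYK

end TriangularArray

/-! ### Sign symmetry of the conditional noise -/

section SymmetricNoise

lemma map_neg_multivariateGaussian_zero {d : ℕ} (S : Matrix (Fin d) (Fin d) ℝ) :
    (multivariateGaussian 0 S).map (fun x => -x) = multivariateGaussian 0 S := by
  by_cases hS : S.PosSemidef
  · have : IsProbabilityMeasure ((multivariateGaussian 0 S).map fun x => -x) :=
      Measure.isProbabilityMeasure_map (by fun_prop)
    refine Measure.ext_of_charFun (funext fun t => ?_)
    have h : charFun ((multivariateGaussian 0 S).map fun x => -x) t =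
        charFun (multivariateGaussian 0 S) (-t) := by
      rw [charFun_apply, charFun_apply, integral_map (by fun_prop)
        (Measurable.aestronglyMeasurable (by fun_prop))]
      simp
    rw [h, charFun_multivariateGaussian hS, charFun_multivariateGaussian hS]
    simp [mulVec_neg]
  -- Without positive semidefiniteness the Gaussian is by convention a Dirac mass at its mean `0`,
  -- again symmetric.
  · rw [multivariateGaussian_of_not_posSemidef _ hS, Measure.map_dirac' measurable_neg]
    simp

variable {Ω : Type*} [MeasurableSpace Ω] {P : Measure Ω} [IsProbabilityMeasure P]

/-- If `Y` has a symmetric conditional law given `X`, then `(X, Y)` and `(X, -Y)` have the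
same law. -/
lemma identDistrib_prodMk_neg {β : Type*} [MeasurableSpace β] {d : ℕ} {X : Ω → β}
    {Y : Ω → Weights d} (hX : Measurable X) (hY : Measurable Y)
    (hsymm : ∀ᵐ ω ∂P, (condDistrib Y X P (X ω)).map (fun y => -y) = condDistrib Y X P (X ω)) :
    IdentDistrib (fun ω => (X ω, Y ω)) (fun ω => (X ω, -Y ω)) P P := by
  have hXY : Measurable fun ω => (X ω, Y ω) := hX.prodMk hY
  refine ⟨hXY.aemeasurable, (hX.prodMk hY.neg).aemeasurable, ?_⟩
  have hneg : Measurable fun z : β × Weights d => (z.1, -z.2) := by fun_prop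
  have hmap : P.map (fun ω => (X ω, -Y ω)) =
      (P.map fun ω => (X ω, Y ω)).map fun z => (z.1, -z.2) := by
    rw [Measure.map_map hneg hXY]
    rfl
  rw [hmap, ← compProd_map_condDistrib hY.aemeasurable]
  ext s hs
  rw [Measure.map_apply hneg hs, Measure.compProd_apply hs, Measure.compProd_apply (hneg hs),
    lintegral_map (Kernel.measurable_kernel_prodMk_left hs) hX,
    lintegral_map (Kernel.measurable_kernel_prodMk_left (hneg hs)) hX]
  refine lintegral_congr_ae ?_
  filter_upwards [hsymm] with ω hω
  nth_rw 1 [← hω]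
  rw [Measure.map_apply measurable_neg (measurable_prodMk_left hs)]
  rfl

end SymmetricNoise

/-! ### Measurability and locality of the SGD iterates -/

section Measurability

variable {d : ℕ} (c : Client d)

lemma measurable_gradient (f : Weights d → ℝ) : Measurable (∇ f) :=
  (InnerProductSpace.toDual ℝ (Weights d)).symm.continuous.measurable.comp (measurable_fderiv ℝ f)

lemma Client.measurable_iterate (η : ℝ) (w₀ : Weights d) {β : Type*} [MeasurableSpace β]
    {n : β → ℕ → Weights d} : ∀ {i : ℕ}, (∀ j < i, Measurable fun x => n x j) →
      Measurable fun x => c.iterate η w₀ (n x) i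
  | 0, _ => measurable_const
  | i + 1, hn => by
    have ih := Client.measurable_iterate η w₀ fun j hj => hn j (hj.trans i.lt_succ_self)
    exact ih.add (((hn i i.lt_succ_self).sub ((measurable_gradient _).comp ih)).const_smul η)

lemma Client.iterate_congr (η : ℝ) (w₀ : Weights d) {n n' : ℕ → Weights d} :
    ∀ {i : ℕ}, (∀ j < i, n j = n' j) → c.iterate η w₀ n i = c.iterate η w₀ n' i
  | 0, _ => rfl
  | i + 1, h => by
    simp only [Client.iterate, h i i.lt_succ_self,
      Client.iterate_congr η w₀ fun j hj => h j (hj.trans i.lt_succ_self)]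

end Measurability

/-! ### Independence and centering of the client updates -/

namespace Round

variable {d Q E : ℕ} {Ω : Type*} [MeasurableSpace Ω] {𝓡 : Round d Q Ω} {P : Measure Ω}

variable (𝓡 P E) in
/-- The centered local update `N_k + R_k` of client `k`. -/
noncomputable def centeredUpdate (k : Fin Q) (ω : Ω) : Weights d :=
  𝓡.totalNoise E k ω + 𝓡.totalDev P E k ω

variable (𝓡 P E) in
/-- The centered local update of client `k` as a function of its gradient noise. -/
noncomputable def centeredUpdateMap (k : Fin Q) (x : Fin E → Weights d) : Weights d :=
  -- The padding value `0` does not affect the result: only noises of index below `E` enter.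
  let n : ℕ → Weights d := fun j => if h : j < E then x ⟨j, h⟩ else 0
  ∑ i ∈ Finset.range E, n i + ∑ i ∈ Finset.range E, ((∫ ω', 𝓡.grad k i ω' ∂P) -
    ∇ (𝓡.client k).loss ((𝓡.client k).iterate (𝓡.η k) 𝓡.w₀ n i))

lemma measurable_centeredUpdateMap (k : Fin Q) : Measurable (𝓡.centeredUpdateMap E P k) := by
  have hn : ∀ j, Measurable fun x : Fin E → Weights d =>
      if h : j < E then x ⟨j, h⟩ else (0 : Weights d) := fun j => by
    split_ifs with h
    · exact measurable_pi_apply _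
    · exact measurable_const
  refine (Finset.measurable_sum _ fun i _ => hn i).add
    (Finset.measurable_sum _ fun i _ => measurable_const.sub ?_)
  exact (measurable_gradient _).comp (Client.measurable_iterate _ _ _ fun j _ => hn j)

lemma centeredUpdateMap_noise (k : Fin Q) (ω : Ω) :
    𝓡.centeredUpdateMap E P k (fun i => 𝓡.noise k i ω) = 𝓡.centeredUpdate E P k ω := by
  unfold centeredUpdateMap centeredUpdate totalNoise totalDev grad weights
  refine congrArg₂ (· + ·) (Finset.sum_congr rfl fun i hi => ?_) (Finset.sum_congr rfl fun i hi => ?_)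
  · simp [Finset.mem_range.1 hi]
  · refine congrArg _ (congrArg _ (Client.iterate_congr _ _ _ fun j hj => ?_))
    simp [hj.trans (Finset.mem_range.1 hi)]

namespace IsModel

variable [IsProbabilityMeasure P]

lemma measurable_centeredUpdate (h : 𝓡.IsModel P E) (k : Fin Q) : Measurable (𝓡.centeredUpdate E P k) := by
  have := (measurable_centeredUpdateMap (𝓡 := 𝓡) (P := P) (E := E) k).comp
    (measurable_pi_lambda (fun ω (i : Fin E) => 𝓡.noise k i ω)
      fun i => h.measurable_noise k i i.2)
  simpa only [Function.comp_def, centeredUpdateMap_noise] using this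

lemma iIndepFun_centeredUpdate (h : 𝓡.IsModel P E) : iIndepFun (𝓡.centeredUpdate E P) P := by
  have := h.indep.comp _ fun k => measurable_centeredUpdateMap (𝓡 := 𝓡) (P := P) (E := E) k
  simpa only [Function.comp_def, centeredUpdateMap_noise] using this

lemma measurable_totalNoise (h : 𝓡.IsModel P E) (k : Fin Q) : Measurable (𝓡.totalNoise E k) :=
  Finset.measurable_sum _ fun i hi => h.measurable_noise k i (Finset.mem_range.1 hi)

lemma identDistrib_past_noise (h : 𝓡.IsModel P E) (k : Fin Q) {i : ℕ} (hi : i < E) :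
    IdentDistrib (fun ω => ((fun j : Fin i => 𝓡.noise k j ω), 𝓡.noise k i ω))
      (fun ω => ((fun j : Fin i => 𝓡.noise k j ω), -𝓡.noise k i ω)) P P := by
  refine identDistrib_prodMk_neg (X := fun ω (j : Fin i) => 𝓡.noise k j ω)
    (measurable_pi_lambda _ fun j => h.measurable_noise k j (j.2.trans hi))
    (h.measurable_noise k i hi) ?_
  filter_upwards [h.condDistrib_noise k i hi] with ω hω
  rw [hω, map_neg_multivariateGaussian_zero]

/-- Partial sums of the gradient noise inherit the integrability of the whole sum. -/
lemma memLp_partialNoise (h : 𝓡.IsModel P E) (k : Fin Q) (a : Fin d) {q : ENNReal}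
    (hN : MemLp (fun ω => 𝓡.totalNoise E k ω a) q P) {i : ℕ} (hi : i ≤ E) :
    MemLp (fun ω => ∑ j ∈ Finset.range i, 𝓡.noise k j ω a) q P := by
  induction hi using Nat.decreasingInduction with
  | self => simpa [totalNoise] using hN
  | of_succ i hi ih =>
    -- With `S` the sum of the first `i` noises and `n` the next one, `S - n` has the law of `S +
    -- n`, hence lies in the same `L^q`; `S` is the average of the two.
    have hid := (h.identDistrib_past_noise k hi).comp
      (u := fun z : (Fin i → Weights d) × Weights d => ∑ j, z.1 j a + z.2 a) (by fun_prop)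
    have h1 : ∀ ω, ∑ j ∈ Finset.range (i + 1), 𝓡.noise k j ω a =
        ∑ j : Fin i, 𝓡.noise k j ω a + 𝓡.noise k i ω a := fun ω => by
      rw [Finset.sum_range_succ, Finset.sum_range]
    simp_rw [h1] at ih
    have ih' := hid.memLp_iff.1 ih
    have hhalf := (ih.add ih').const_mul (1 / 2)
    refine hhalf.congr_norm ?_ (ae_of_all _ fun ω => ?_)
    · refine Measurable.aestronglyMeasurable (Finset.measurable_fun_sum _ fun j hj => ?_)
      have := h.measurable_noise k j ((Finset.mem_range.1 hj).trans hi)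
      fun_prop
    · congr 1
      simp [Finset.sum_range]
      ring

lemma memLp_noise (h : 𝓡.IsModel P E) (k : Fin Q) (a : Fin d) {q : ENNReal}
    (hN : MemLp (fun ω => 𝓡.totalNoise E k ω a) q P) {i : ℕ} (hi : i < E) :
    MemLp (fun ω => 𝓡.noise k i ω a) q P := by
  have := (h.memLp_partialNoise k a hN (i := i + 1) hi).sub
    (h.memLp_partialNoise k a hN (i := i) hi.le)
  refine this.ae_eq (ae_of_all _ fun ω => ?_)
  simp [Finset.sum_range_succ]

/-- The noise and its negative have the same law, so the integral equals its own negative. -/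
lemma integral_noise (h : 𝓡.IsModel P E) (k : Fin Q) (a : Fin d) {i : ℕ} (hi : i < E) :
    ∫ ω, 𝓡.noise k i ω a ∂P = 0 := by
  have hid := ((h.identDistrib_past_noise k hi).comp
    (u := fun z : (Fin i → Weights d) × Weights d => z.2 a) (by fun_prop)).integral_eq
  simp only [Function.comp_def, PiLp.neg_apply, integral_neg] at hid
  linarith

lemma integral_totalNoise (h : 𝓡.IsModel P E) (k : Fin Q) (a : Fin d)
    (hN : Integrable (fun ω => 𝓡.totalNoise E k ω a) P) :
    ∫ ω, 𝓡.totalNoise E k ω a ∂P = 0 := by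
  simp only [totalNoise, WithLp.ofLp_sum, Finset.sum_apply]
  rw [integral_finsetSum _ fun i hi => memLp_one_iff_integrable.1
    (h.memLp_noise k a (memLp_one_iff_integrable.2 hN) (Finset.mem_range.1 hi))]
  exact Finset.sum_eq_zero fun i hi => h.integral_noise k a (Finset.mem_range.1 hi)

lemma integral_totalDev (h : 𝓡.IsModel P E) (k : Fin Q) (a : Fin d) : ∫ ω, 𝓡.totalDev P E k ω a ∂P = 0 := by
  have hG : ∀ i ∈ Finset.range E, ∀ b, Integrable (fun ω => 𝓡.grad k i ω b) P := fun i hi =>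
    (h.integrable_grad k i (Finset.mem_range.1 hi)).eval_piLp
  simp only [totalDev, WithLp.ofLp_sum, Finset.sum_apply, PiLp.sub_apply]
  have hd : ∀ i ∈ Finset.range E, Integrable
      (fun ω => (∫ ω', 𝓡.grad k i ω' ∂P) a - 𝓡.grad k i ω a) P := fun i hi =>
    (integrable_const _).sub (hG i hi a)
  rw [integral_finsetSum _ hd]
  refine Finset.sum_eq_zero fun i hi => ?_
  rw [integral_sub (integrable_const _) (hG i hi a), eval_integral_piLp (hG i hi)]
  simp

end IsModel

end Round

/-! ### Moments and covariance of the server update -/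

namespace Round

variable {d Q E : ℕ} {Ω : Type*} [MeasurableSpace Ω] {𝓡 : Round d Q Ω} {P : Measure Ω}

/-- Adding and subtracting the expected gradients isolates a deterministic shift, which affects the
mean but no covariance. -/
lemma update_apply (ω : Ω) (a : Fin d) :
    𝓡.update E ω a = ∑ k, 𝓡.p k * 𝓡.η k * 𝓡.centeredUpdate E P k ω a -
      ∑ k, 𝓡.p k * 𝓡.η k * ∑ i ∈ Finset.range E, (∫ ω', 𝓡.grad k i ω' ∂P) a := by
  rw [← Finset.sum_sub_distrib]
  simp_rw [← mul_sub]
  simp only [update, centeredUpdate, totalNoise, totalDev, WithLp.ofLp_sum, Finset.sum_apply,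
    PiLp.smul_apply, PiLp.add_apply, PiLp.sub_apply, smul_eq_mul, Finset.sum_sub_distrib,
    ← Finset.mul_sum]
  exact Finset.sum_congr rfl fun k _ => by ring

lemma scaledMoment_nonneg (k : Fin Q) (a : Fin d) : 0 ≤ 𝓡.scaledMoment P E k a :=
  mul_nonneg (by positivity) (integral_nonneg fun _ => sq_nonneg _)

variable [IsProbabilityMeasure P]

lemma IsModel.memLp_totalNoise (h : 𝓡.IsModel P E) {k : Fin Q} {a : Fin d}
    (hmom : Integrable (fun ω => 𝓡.totalNoise E k ω a ^ 4) P) :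
    MemLp (fun ω => 𝓡.totalNoise E k ω a) 4 P := by
  have := h.measurable_totalNoise k
  exact memLp_four_of_integrable_pow (Measurable.aestronglyMeasurable (by fun_prop)) hmom

lemma IsModel.memLp_totalDev (h : 𝓡.IsModel P E) {k : Fin Q} {a : Fin d}
    (hmom : Integrable (fun ω => 𝓡.totalDev P E k ω a ^ 4) P) :
    MemLp (fun ω => 𝓡.totalDev P E k ω a) 4 P := by
  have h1 := h.measurable_totalNoise k
  have h2 := h.measurable_centeredUpdate k
  have he : (fun ω => 𝓡.totalDev P E k ω a) =
      fun ω => 𝓡.centeredUpdate E P k ω a - 𝓡.totalNoise E k ω a := by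
    ext ω
    simp [centeredUpdate]
  refine memLp_four_of_integrable_pow ?_ hmom
  rw [he]
  exact Measurable.aestronglyMeasurable (by fun_prop)

variable (𝓡 P E) in
/-- Fourth moments of the accumulated noise and of the accumulated gradient deviation exist and are
bounded by `D`. -/
structure FourthMomentBound (D : ℝ) : Prop where
  integrable_noise : ∀ k a, Integrable (fun ω => 𝓡.totalNoise E k ω a ^ 4) P
  integral_noise_le : ∀ k a, ∫ ω, 𝓡.totalNoise E k ω a ^ 4 ∂P ≤ D
  integrable_dev : ∀ k a, Integrable (fun ω => 𝓡.totalDev P E k ω a ^ 4) P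
  integral_dev_le : ∀ k a, ∫ ω, 𝓡.totalDev P E k ω a ^ 4 ∂P ≤ D

namespace IsModel

variable {D : ℝ}

lemma memLp_centeredUpdate (h : 𝓡.IsModel P E) (hD : 𝓡.FourthMomentBound E P D) (k : Fin Q)
    (a : Fin d) : MemLp (fun ω => 𝓡.centeredUpdate E P k ω a) 4 P :=
  (h.memLp_totalNoise (hD.integrable_noise k a)).add (h.memLp_totalDev (hD.integrable_dev k a))

lemma integral_centeredUpdate (h : 𝓡.IsModel P E) (hD : 𝓡.FourthMomentBound E P D) (k : Fin Q)
    (a : Fin d) : ∫ ω, 𝓡.centeredUpdate E P k ω a ∂P = 0 := by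
  have h1 : Integrable (fun ω => 𝓡.totalNoise E k ω a) P :=
    (h.memLp_totalNoise (hD.integrable_noise k a)).integrable (by norm_num)
  have h2 : Integrable (fun ω => 𝓡.totalDev P E k ω a) P :=
    (h.memLp_totalDev (hD.integrable_dev k a)).integrable (by norm_num)
  simp only [centeredUpdate, PiLp.add_apply]
  rw [integral_add h1 h2, h.integral_totalNoise k a h1, h.integral_totalDev, add_zero]

lemma integral_centeredUpdate_pow_four_le (h : 𝓡.IsModel P E) (hD : 𝓡.FourthMomentBound E P D)
    (k : Fin Q) (a : Fin d) : ∫ ω, 𝓡.centeredUpdate E P k ω a ^ 4 ∂P ≤ 16 * D := by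
  have h1 := hD.integrable_noise k a
  have h2 := hD.integrable_dev k a
  calc ∫ ω, 𝓡.centeredUpdate E P k ω a ^ 4 ∂P
      ≤ ∫ ω, 8 * (𝓡.totalNoise E k ω a ^ 4 + 𝓡.totalDev P E k ω a ^ 4) ∂P := by
        refine integral_mono (integrable_pow_of_memLp (h.memLp_centeredUpdate hD k a) le_rfl)
          ((h1.add h2).const_mul 8) fun ω => ?_
        -- Two summands give the factor `2 ^ 3 = 8`.
        have := sum_pow_four_le ![𝓡.totalNoise E k ω a, 𝓡.totalDev P E k ω a]
        norm_num [Fin.sum_univ_two] at this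
        simpa [centeredUpdate] using this
    _ = 8 * (∫ ω, 𝓡.totalNoise E k ω a ^ 4 ∂P + ∫ ω, 𝓡.totalDev P E k ω a ^ 4 ∂P) := by
        rw [integral_const_mul, integral_add h1 h2]
    _ ≤ 16 * D := by linarith [hD.integral_noise_le k a, hD.integral_dev_le k a]

lemma memLp_update (h : 𝓡.IsModel P E) (hD : 𝓡.FourthMomentBound E P D) (a : Fin d) :
    MemLp (fun ω => 𝓡.update E ω a) 2 P := by
  simp_rw [update_apply (P := P)]
  exact (memLp_finsetSum _ fun k _ => ((h.memLp_centeredUpdate hD k a).mono_exponent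
    (by norm_num)).const_mul _).sub (memLp_const _)

lemma update_sub_mean (h : 𝓡.IsModel P E) (hD : 𝓡.FourthMomentBound E P D) (ω : Ω) (a : Fin d) :
    𝓡.update E ω a - 𝓡.mean P E a = ∑ k, 𝓡.p k * 𝓡.η k * 𝓡.centeredUpdate E P k ω a := by
  have hint : ∀ k, Integrable (fun ω => 𝓡.p k * 𝓡.η k * 𝓡.centeredUpdate E P k ω a) P := fun k =>
    ((h.memLp_centeredUpdate hD k a).integrable (by norm_num)).const_mul _
  have hm : 𝓡.mean P E a =
      -∑ k, 𝓡.p k * 𝓡.η k * ∑ i ∈ Finset.range E, (∫ ω', 𝓡.grad k i ω' ∂P) a := by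
    rw [mean, eval_integral_piLp fun b => (h.memLp_update hD b).integrable (by norm_num)]
    simp_rw [update_apply (P := P)]
    rw [integral_sub (integrable_finsetSum _ fun k _ => hint k) (integrable_const _),
      integral_finsetSum _ fun k _ => hint k]
    simp [integral_const_mul, h.integral_centeredUpdate hD]
  rw [hm, update_apply (P := P)]
  ring

/-- Independence removes the cross terms between clients, and centering turns each variance into a
second moment. -/
lemma covMatrix_diag (h : 𝓡.IsModel P E) (hD : 𝓡.FourthMomentBound E P D) (a : Fin d) :
    𝓡.covMatrix P E a a = ∑ k, 𝓡.scaledMoment P E k a := by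
  let Y : Fin Q → Ω → ℝ := fun k ω => 𝓡.p k * 𝓡.η k * 𝓡.centeredUpdate E P k ω a
  have hY : ∀ k, MemLp (Y k) 2 P := fun k =>
    ((h.memLp_centeredUpdate hD k a).mono_exponent (by norm_num)).const_mul _
  have hind : iIndepFun Y P := h.iIndepFun_centeredUpdate.comp
    (fun k x => 𝓡.p k * 𝓡.η k * x a) fun k => by fun_prop
  have hY0 : ∀ k, ∫ ω, Y k ω ∂P = 0 := fun k => by
    simp [Y, integral_const_mul, h.integral_centeredUpdate hD]
  have hu : (fun ω => 𝓡.update E ω a) = fun ω => (∑ k, Y k) ω + 𝓡.mean P E a := by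
    ext ω
    rw [Finset.sum_apply]
    linarith [h.update_sub_mean hD ω a]
  rw [covMatrix, Matrix.of_apply, covariance_self (h.memLp_update hD a).1.aemeasurable, hu,
    variance_add_const (memLp_finsetSum' _ fun k _ => hY k).1,
    IndepFun.variance_sum (fun k _ => hY k) fun i _ j _ hij => hind.indepFun hij]
  refine Finset.sum_congr rfl fun k _ => ?_
  rw [variance_of_integral_eq_zero (hY k).1.aemeasurable (hY0 k), scaledMoment,
    ← integral_const_mul]
  refine integral_congr_ae (ae_of_all _ fun ω => ?_)
  simp only [Y, centeredUpdate, PiLp.add_apply]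
  ring

end IsModel

lemma covMatrix_posSemidef (h : 𝓡.IsModel P E) {D : ℝ} (hD : 𝓡.FourthMomentBound E P D) :
    (𝓡.covMatrix P E).PosSemidef :=
  posSemidef_covariance (X := fun a ω => 𝓡.update E ω a) (h.memLp_update hD)

variable (𝓡 P E) in
/-- The correlation matrix of the server update. -/
noncomputable def corrMatrix : Matrix (Fin d) (Fin d) ℝ :=
  Matrix.of fun a b => cov[fun ω => 𝓡.standardize P E (𝓡.update E ω) a,
    fun ω => 𝓡.standardize P E (𝓡.update E ω) b; P]

/-! ### The standardized update and its correlation matrix -/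

namespace IsModel

variable {D : ℝ}

lemma memLp_standardize (h : 𝓡.IsModel P E) (hD : 𝓡.FourthMomentBound E P D) (a : Fin d) :
    MemLp (fun ω => 𝓡.standardize P E (𝓡.update E ω) a) 2 P := by
  simp only [standardize, div_eq_inv_mul]
  exact ((h.memLp_update hD a).sub (memLp_const _)).const_mul _

lemma corrMatrix_apply (h : 𝓡.IsModel P E) (hD : 𝓡.FourthMomentBound E P D) (a b : Fin d) :
    𝓡.corrMatrix E P a b =
      (√(𝓡.covMatrix P E a a))⁻¹ * (√(𝓡.covMatrix P E b b))⁻¹ * 𝓡.covMatrix P E a b := by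
  simp only [corrMatrix, Matrix.of_apply, standardize, div_eq_inv_mul]
  rw [covariance_const_mul_left, covariance_const_mul_right,
    covariance_sub_const_left ((h.memLp_update hD a).integrable (by norm_num)),
    covariance_sub_const_right ((h.memLp_update hD b).integrable (by norm_num))]
  simp only [covMatrix, Matrix.of_apply]
  ring

lemma corrMatrix_posSemidef (h : 𝓡.IsModel P E) (hD : 𝓡.FourthMomentBound E P D) :
    (𝓡.corrMatrix E P).PosSemidef :=
  posSemidef_covariance (X := fun a ω => 𝓡.standardize P E (𝓡.update E ω) a)
    (h.memLp_standardize hD)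

lemma corrMatrix_diag (h : 𝓡.IsModel P E) (hD : 𝓡.FourthMomentBound E P D) {a : Fin d}
    (hV : 0 < 𝓡.covMatrix P E a a) : 𝓡.corrMatrix E P a a = 1 := by
  have hs := Real.sqrt_pos.2 hV
  rw [h.corrMatrix_apply hD]
  nth_rw 3 [← Real.mul_self_sqrt hV.le]
  field_simp

lemma corrMatrix_diag_le (h : 𝓡.IsModel P E) (hD : 𝓡.FourthMomentBound E P D) (a : Fin d) :
    𝓡.corrMatrix E P a a ≤ 1 := by
  rcases ((covMatrix_posSemidef h hD).diag_nonneg (i := a)).lt_or_eq with hV | hV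
  · exact (h.corrMatrix_diag hD hV).le
  -- Zero variance, as for `Q = 0`: since `0⁻¹ = 0`, the entry is `0`.
  · rw [h.corrMatrix_apply hD, ← hV]
    simp

lemma integral_gaussian_standardize (h : 𝓡.IsModel P E) (hD : 𝓡.FourthMomentBound E P D)
    (f : Weights d →ᵇ ℝ) :
    ∫ x, f (𝓡.standardize P E x) ∂multivariateGaussian (𝓡.mean P E) (𝓡.covMatrix P E) =
      ∫ x, f x ∂multivariateGaussian 0 (𝓡.corrMatrix E P) := by
  have hs : 𝓡.standardize P E = fun x => (WithLp.toLp 2 fun a =>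
      (√(𝓡.covMatrix P E a a))⁻¹ * (x a - 𝓡.mean P E a) : Weights d) := by
    ext x a
    simp [standardize, div_eq_inv_mul]
  rw [← map_multivariateGaussian_rescale (𝓡.mean P E) (covMatrix_posSemidef h hD)
    (fun a => (√(𝓡.covMatrix P E a a))⁻¹) (h.corrMatrix_posSemidef hD) (h.corrMatrix_apply hD),
    integral_map (Measurable.aemeasurable (by fun_prop))
      f.continuous.measurable.aestronglyMeasurable, hs]

/-- Quantitative comparison of the characteristic function of the standardized server update with
that of the centered Gaussian of the same covariance matrix. -/
lemma norm_charFun_standardize_sub_exp_le (h : 𝓡.IsModel P E) (hD : 𝓡.FourthMomentBound E P D)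
    (hQ : 0 < Q) {B C : ℝ} (hB : ∀ k, |𝓡.p k * 𝓡.η k| ≤ B) (hC : 0 < C)
    (hx : ∀ k a, √C ≤ 𝓡.scaledMoment P E k a) (t : Weights d) :
    ‖charFun (P.map fun ω => 𝓡.standardize P E (𝓡.update E ω)) t -
        Complex.exp (-((t.ofLp ⬝ᵥ 𝓡.corrMatrix E P *ᵥ t.ofLp : ℝ) : ℂ) / 2)‖ ≤
      (4 + 5 * ((d : ℝ) ^ 3 * (∑ a, t a ^ 4) * (B ^ 4 * (16 * D) / C))) / √(Q : ℝ) := by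
  have hV : ∀ a, Q * √C ≤ 𝓡.covMatrix P E a a := fun a => by
    rw [h.covMatrix_diag hD]
    simpa using Finset.card_nsmul_le_sum Finset.univ _ _ fun k _ => hx k a
  have hQ' : (0 : ℝ) < Q := by exact_mod_cast hQ
  have hV0 : ∀ a, 0 < 𝓡.covMatrix P E a a := fun a =>
    (mul_pos hQ' (Real.sqrt_pos.2 hC)).trans_le (hV a)
  let r : Fin Q → Fin d → ℝ := fun k a => (√(𝓡.covMatrix P E a a))⁻¹ * (𝓡.p k * 𝓡.η k)
  let X : Fin Q → Ω → Weights d := fun k ω =>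
    WithLp.toLp 2 fun a => r k a * 𝓡.centeredUpdate E P k ω a
  have hsum : (fun ω => 𝓡.standardize P E (𝓡.update E ω)) = fun ω => ∑ k, X k ω := by
    ext ω a
    simp only [standardize, h.update_sub_mean hD, X, r, WithLp.ofLp_sum, Finset.sum_apply,
      div_eq_inv_mul, Finset.mul_sum, mul_assoc]
  have hind : iIndepFun X P := h.iIndepFun_centeredUpdate.comp
    (fun k x => (WithLp.toLp 2 fun a => r k a * x a : Weights d)) fun k => by fun_prop
  have hXm : ∀ k, Measurable (X k) := fun k => by
    have := h.measurable_centeredUpdate k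
    fun_prop
  -- The variance grows at least like `Q √C`, so its inverse square, which scales fourth moments, is
  -- at most `1 / (C Q ^ 2)`.
  have hr : ∀ k a, r k a ^ 4 ≤ B ^ 4 / C / (Q : ℝ) ^ 2 := fun k a => by
    have h1 : (√(𝓡.covMatrix P E a a))⁻¹ ^ 4 = (𝓡.covMatrix P E a a ^ 2)⁻¹ := by
      rw [inv_pow, show (4 : ℕ) = 2 * 2 from rfl, pow_mul, Real.sq_sqrt (hV0 a).le]
    have h2 : C * (Q : ℝ) ^ 2 ≤ 𝓡.covMatrix P E a a ^ 2 := by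
      have := pow_le_pow_left₀ (by positivity) (hV a) 2
      rwa [mul_pow, Real.sq_sqrt hC.le, mul_comm] at this
    have h3 : (𝓡.p k * 𝓡.η k) ^ 4 ≤ B ^ 4 := by
      rw [← Even.pow_abs (by decide : Even 4) (𝓡.p k * 𝓡.η k)]
      exact pow_le_pow_left₀ (abs_nonneg _) (hB k) 4
    calc r k a ^ 4 = (𝓡.covMatrix P E a a ^ 2)⁻¹ * (𝓡.p k * 𝓡.η k) ^ 4 := by
          rw [mul_pow, h1]
      _ ≤ (C * (Q : ℝ) ^ 2)⁻¹ * B ^ 4 := by gcongr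
      _ = _ := by field_simp
  have key := norm_charFun_sum_sub_exp_le hQ hXm hind (K := B ^ 4 * (16 * D) / C)
    (fun k a => (h.memLp_centeredUpdate hD k a).const_mul (r k a))
    (fun k a => by simp [X, integral_const_mul, h.integral_centeredUpdate hD])
    (fun k a => by
      simp only [X, mul_pow, integral_const_mul]
      calc r k a ^ 4 * ∫ ω, 𝓡.centeredUpdate E P k ω a ^ 4 ∂P
          ≤ (B ^ 4 / C / (Q : ℝ) ^ 2) * (16 * D) := by
            refine mul_le_mul (hr k a) (h.integral_centeredUpdate_pow_four_le hD k a)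
              (integral_nonneg fun ω => by positivity) (by positivity)
        _ = _ := by ring) t
  have hcorr : 𝓡.corrMatrix E P = Matrix.of fun a b =>
      cov[fun ω => (∑ k, X k ω) a, fun ω => (∑ k, X k ω) b; P] := by
    have hω : ∀ ω, 𝓡.standardize P E (𝓡.update E ω) = ∑ k, X k ω := congrFun hsum
    simp only [corrMatrix, hω]
  rw [hsum, hcorr]
  exact key

end IsModel

end Round

/-- Dropping the nonnegative dispersion term `s` turns hypothesis 3 into a uniform lower bound on
the scaled moments. -/
lemma sqrt_le_of_le_sq_sub {C x s : ℝ} (hx : 0 ≤ x) (hs : 0 ≤ s) (h : C ≤ x ^ 2 - s) :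
    √C ≤ x :=
  Real.sqrt_le_iff.2 ⟨hx, by linarith⟩

end FedAvg

/-! ### Asymptotic normality of the server update -/

theorem theorem3 {d : ℕ} (E : ℕ) {Ω : ℕ → Type*} [∀ Q, MeasurableSpace (Ω Q)]
    (P : ∀ Q, Measure (Ω Q)) [∀ Q, IsProbabilityMeasure (P Q)]
    (𝓡 : ∀ Q, FedAvg.Round d Q (Ω Q)) (model : ∀ Q, (𝓡 Q).IsModel (P Q) E)
    -- uniformly bounded effective step sizes
    (B : ℝ) (hB : ∀ Q k, |(𝓡 Q).p k * (𝓡 Q).η k| ≤ B)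
    -- diagonal client covariances
    (hdiag : ∀ Q k, ∀ i < E, ∀ᵐ ω ∂P Q,
      (((𝓡 Q).client k).gradCov ((𝓡 Q).weights k i ω)).IsDiag)
    -- second moments that are not too different across clients
    (C : ℝ) (hC : 0 < C)
    (hdiv : ∀ Q k a, C ≤ (𝓡 Q).scaledMoment (P Q) E k a ^ 2 -
      1 / (2 * (Q : ℝ)) *
        ∑ j, ((𝓡 Q).scaledMoment (P Q) E k a - (𝓡 Q).scaledMoment (P Q) E j a) ^ 2)
    -- bounded fourth-order mixed moments
    (D : ℝ)
    (hmom : ∀ Q k a, ∀ u v : ℕ, u + v = 4 →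
      Integrable (fun ω => (𝓡 Q).totalNoise E k ω a ^ u * (𝓡 Q).totalDev (P Q) E k ω a ^ v) (P Q) ∧
      |∫ ω, (𝓡 Q).totalNoise E k ω a ^ u * (𝓡 Q).totalDev (P Q) E k ω a ^ v ∂P Q| ≤ D) :
    -- the mean and the covariance matrix exist, and the variances do not vanish
    (∀ Q, MemLp ((𝓡 Q).update E) 2 (P Q)) ∧
    (∀ Q, 1 ≤ Q → ∀ a, 0 < (𝓡 Q).covMatrix (P Q) E a a) ∧
    -- every standardized coordinate converges in distribution to `𝒩(0, 1)`
    (∀ a, TendstoInDistribution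
      (fun Q ω => (𝓡 Q).standardize (P Q) E ((𝓡 Q).update E ω) a) atTop
      (id : ℝ → ℝ) P (gaussianReal 0 1)) ∧
    -- jointly, the laws of `A_T` and of `𝒩(M_T, V_T)`, standardized by the same affine map,
    -- have the same weak asymptotics
    (∀ f : FedAvg.Weights d →ᵇ ℝ, Tendsto
      (fun Q => (∫ ω, f ((𝓡 Q).standardize (P Q) E ((𝓡 Q).update E ω)) ∂P Q) -
        ∫ x, f ((𝓡 Q).standardize (P Q) E x)
          ∂multivariateGaussian ((𝓡 Q).mean (P Q) E) ((𝓡 Q).covMatrix (P Q) E))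
      atTop (𝓝 0)) := by
  have hD : ∀ Q, (𝓡 Q).FourthMomentBound E (P Q) D := fun Q =>
    { integrable_noise := fun k a => by simpa using (hmom Q k a 4 0 rfl).1
      integral_noise_le := fun k a => by simpa using (le_abs_self _).trans (hmom Q k a 4 0 rfl).2
      integrable_dev := fun k a => by simpa using (hmom Q k a 0 4 rfl).1
      integral_dev_le := fun k a => by simpa using (le_abs_self _).trans (hmom Q k a 0 4 rfl).2 }
  have hx : ∀ Q k a, √C ≤ (𝓡 Q).scaledMoment (P Q) E k a := fun Q k a =>
    FedAvg.sqrt_le_of_le_sq_sub (FedAvg.Round.scaledMoment_nonneg k a)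
      (mul_nonneg (by positivity) (Finset.sum_nonneg fun j _ => sq_nonneg _)) (hdiv Q k a)
  have hupd : ∀ Q, MemLp ((𝓡 Q).update E) 2 (P Q) := fun Q =>
    MemLp.of_eval_piLp fun a => (model Q).memLp_update (hD Q) a
  have hpos : ∀ Q, 1 ≤ Q → ∀ a, 0 < (𝓡 Q).covMatrix (P Q) E a a := fun Q hQ a => by
    rw [(model Q).covMatrix_diag (hD Q)]
    exact Finset.sum_pos (fun k _ => (Real.sqrt_pos.2 hC).trans_le (hx Q k a))
      ⟨⟨0, hQ⟩, Finset.mem_univ _⟩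
  have hmeas : ∀ Q, AEMeasurable (fun ω => (𝓡 Q).standardize (P Q) E ((𝓡 Q).update E ω)) (P Q) :=
    fun Q => (MemLp.of_eval_piLp fun a => (model Q).memLp_standardize (hD Q) a).1.aemeasurable
  let μ : ℕ → ProbabilityMeasure (FedAvg.Weights d) := fun Q =>
    ⟨(P Q).map fun ω => (𝓡 Q).standardize (P Q) E ((𝓡 Q).update E ω),
      Measure.isProbabilityMeasure_map (hmeas Q)⟩
  have hchar : ∀ t : FedAvg.Weights d, Tendsto
      (fun Q => charFun (μ Q : Measure (FedAvg.Weights d)) t - Complex.exp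
        (-((t.ofLp ⬝ᵥ Matrix.mulVec ((𝓡 Q).corrMatrix E (P Q)) t.ofLp : ℝ) : ℂ) / 2))
      atTop (𝓝 0) := fun t => by
    refine squeeze_zero_norm' (a := fun Q : ℕ => (4 + 5 * ((d : ℝ) ^ 3 * (∑ a, t a ^ 4) *
      (B ^ 4 * (16 * D) / C))) / √(Q : ℝ)) ?_ (Tendsto.div_atTop tendsto_const_nhds
        (Real.tendsto_sqrt_atTop.comp tendsto_natCast_atTop_atTop))
    filter_upwards [eventually_gt_atTop 0] with Q hQ
    exact (model Q).norm_charFun_standardize_sub_exp_le (hD Q) hQ (hB Q) hC (hx Q) t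
  refine ⟨hupd, hpos, fun a => ?_, fun f => ?_⟩
  · have hmeas_a : ∀ Q, AEMeasurable
        (fun ω => (𝓡 Q).standardize (P Q) E ((𝓡 Q).update E ω) a) (P Q) := fun Q =>
      ((model Q).memLp_standardize (hD Q) a).1.aemeasurable
    refine ⟨hmeas_a, by fun_prop, ProbabilityMeasure.tendsto_iff_tendsto_charFun.2 fun τ => ?_⟩
    have hproj : ∀ Q, charFun
        ((P Q).map fun ω => (𝓡 Q).standardize (P Q) E ((𝓡 Q).update E ω) a) τ =
          charFun (μ Q : Measure (FedAvg.Weights d)) (EuclideanSpace.single a τ) := fun Q => by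
      simp only [μ, ProbabilityMeasure.coe_mk]
      rw [charFun_apply, charFun_apply, integral_map (hmeas_a Q)
        (Measurable.aestronglyMeasurable (by fun_prop)), integral_map (hmeas Q)
        (Measurable.aestronglyMeasurable (by fun_prop))]
      simp [EuclideanSpace.inner_single_right, mul_comm]
    have hlim : Tendsto (fun Q => Complex.exp
        (-(((EuclideanSpace.single a τ : FedAvg.Weights d).ofLp ⬝ᵥ
          Matrix.mulVec ((𝓡 Q).corrMatrix E (P Q))
            (EuclideanSpace.single a τ : FedAvg.Weights d).ofLp : ℝ) : ℂ) / 2))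
        atTop (𝓝 (Complex.exp (-(τ : ℂ) ^ 2 / 2))) := by
      -- A coordinate frequency sees only a diagonal entry of the correlation matrix, which equals
      -- `1` once `Q ≥ 1`; so the marginals have a genuine limit.
      refine tendsto_const_nhds.congr' ?_
      filter_upwards [eventually_ge_atTop 1] with Q hQ
      have h1 := (model Q).corrMatrix_diag (hD Q) (hpos Q hQ a)
      simp [h1, sq]
    have hsum := (hchar (EuclideanSpace.single a τ)).add hlim
    simp only [sub_add_cancel, zero_add] at hsum
    simp only [ProbabilityMeasure.coe_mk, hproj, Measure.map_id, charFun_gaussianReal]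
    convert hsum using 2
    simp [neg_div]
  · have hf := FedAvg.tendsto_integral_sub_gaussian μ (fun Q => (𝓡 Q).corrMatrix E (P Q))
      (fun Q => (model Q).corrMatrix_posSemidef (hD Q))
      (fun Q a => (model Q).corrMatrix_diag_le (hD Q) a) hchar f
    refine hf.congr fun Q => ?_
    rw [(model Q).integral_gaussian_standardize (hD Q)]
    simp only [μ, ProbabilityMeasure.coe_mk]
    rw [integral_map (hmeas Q) f.continuous.measurable.aestronglyMeasurable]
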